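/- **Theorem.** Fix $\alpha\in(0,1)$. Put $\sigma=\sqrt{\alpha(1-\alpha)}$ and $\sigma_t=\sigma/\sqrt t$ for $t>0$. Let $W$ be a standard two-dimensional Brownian motion started at $0$, let $|\cdot|$ be the Euclidean norm on $\mathbb R^2$, and let the scaled Conga line at time $t$ be $$u_t(x)=\int_0^1 W(1-s)\,\frac{1}{\sqrt{2\pi}}\,\frac{x+\alpha s}{2\sigma_t s^{3/2}}\exp\left(-\frac{(x-\alpha s)^2}{2\sigma_t^2 s}\right)ds ,\qquad 0<x\le\alpha .$$ For $M>0$ let $L_t^x=\alpha^{-1}\sqrt{-M\sigma_t^2x\log(\sigma_t^2x)}$, and call $x\in(0,\alpha]$ *admissible* at time $t$ if $x>\alpha L_t^x$. There is a deterministic constant $\kappa>0$, depending only on $\alpha$, such that the following hold. 1. For every $M>0$, almost surely there is a (random) $T>0$ such that for all $t\ge T$ and all $x\in(0,\alpha]$ admissible at time $t$, $$\left|u_t(x)-W\left(1-\tfrac{x}{\alpha}\right)\right|\le\kappa\sqrt{-\left(\tfrac{x}{t}\right)^{1/2}\log\left(\tfrac{x}{t}\right)} .$$ 2. In particular, for every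 $\beta\in(0,1)$, almost surely there is $T>0$ such that the bound in 1 holds for all $t\ge T$ and all $x\in[t^{-\beta},\alpha]$. 3. For every $\beta\in(0,1)$ there is a deterministic $t_0$, depending only on $\alpha$ and $\beta$, such that for all $t\ge t_0$ $$\mathbb P\left(\left|u_t(x)-W\left(1-\tfrac{x}{\alpha}\right)\right|>\kappa\sqrt{-\left(\tfrac{x}{t}\right)^{1/2}\log\left(\tfrac{x}{t}\right)}\ \text{ for some } x\in[t^{-\beta},\alpha]\right)\le t^{-2}.$$ 4. Consequently, for every $M>0$, almost surely there is $T>0$ such that for all $t\ge T$ and all $x\in(0,\alpha]$ admissible at time $t$, $$\left|u_t(x)-W\left(1-\tfrac{x}{\alpha}\right)\right|\le\kappa\, t^{-1/4}\sqrt{\log t} .$$ -/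

import Mathlib

open MeasureTheory ProbabilityTheory
open scoped NNReal ENNReal

universe u

/-- A standard planar Brownian motion started at the origin: both coordinates are standard
one-dimensional Brownian motions (with almost surely continuous paths), and the two coordinate
processes are independent. -/
structure IsPlanarBrownian {Ω : Type u} [MeasurableSpace Ω]
    (W : ℝ≥0 → Ω → EuclideanSpace ℝ (Fin 2)) (P : Measure Ω) : Prop where
  coord : ∀ i : Fin 2, IsBrownianReal (fun t ω => W t ω i) P
  indep : IndepFun (fun ω (t : ℝ≥0) => W t ω 0) (fun ω (t : ℝ≥0) => W t ω 1) P

/-- The scaled diffusivity `σ_t = σ / √t`, where `σ = √(α (1 - α))`. -/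
noncomputable def congaSigma (α t : ℝ) : ℝ := √(α * (1 - α)) / √t

/-- The smoothing kernel
`(2π)^{-1/2} (x + α s) / (2 σ_t s^{3/2}) exp (-(x - α s)² / (2 σ_t² s))`. -/
noncomputable def congaKernel (α t x s : ℝ) : ℝ :=
  (√(2 * Real.pi))⁻¹ * ((x + α * s) / (2 * congaSigma α t * s ^ (3 / 2 : ℝ))) *
    Real.exp (-(x - α * s) ^ 2 / (2 * congaSigma α t ^ 2 * s))

/-- The scaled Conga line `u_t(x) = ∫₀¹ W(1 - s) k_t(x, s) ds` driven by the path `w`. -/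
noncomputable def scaledConga (α t : ℝ) (w : ℝ≥0 → EuclideanSpace ℝ (Fin 2)) (x : ℝ) :
    EuclideanSpace ℝ (Fin 2) :=
  ∫ s in (0 : ℝ)..1, congaKernel α t x s • w (Real.toNNReal (1 - s))

/-- The window width `L_t^x = α⁻¹ √(-M σ_t² x log (σ_t² x))`. -/
noncomputable def congaWindow (α M t x : ℝ) : ℝ :=
  α⁻¹ * √(-(M * (congaSigma α t ^ 2 * x) * Real.log (congaSigma α t ^ 2 * x)))

/-- The points `x ∈ (0, α]` that are not too close to the tip: `x > α L_t^x`. -/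
def congaAdmissible (α M t : ℝ) : Set ℝ :=
  {x | x ∈ Set.Ioc 0 α ∧ α * congaWindow α M t x < x}

/-- The distance `|u_t(x) - W(1 - x/α)|`, with the Euclidean norm of the plane. -/
noncomputable def congaError (α t : ℝ) (w : ℝ≥0 → EuclideanSpace ℝ (Fin 2)) (x : ℝ) : ℝ :=
  ‖scaledConga α t w x - w (Real.toNNReal (1 - x / α))‖

/-- The error scale `√(-(x/t)^{1/2} log (x/t))`. -/
noncomputable def congaRate (t x : ℝ) : ℝ :=
  √(-((x / t) ^ (1 / 2 : ℝ) * Real.log (x / t)))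

/-! The map `s ↦ (α s - x) / (σ √s)`, with `σ = congaSigma α t`, is an increasing bijection from
`(0, ∞)` to `ℝ` that carries the kernel to the standard Gaussian density. So the kernel has mass
exactly 1 on `(0, ∞)`, and `∫ k |s - x/α|` is of order `√(x/t)` as soon as `x ≥ 1/t`
(`integrableOn_congaKernel_mul_abs`, `congaSigma_moment_le`). Since the path vanishes at time 0,
extending it by 0 turns the error into a kernel average of increments `W(1-s) - W(1-x/α)`.

Outside an event of probability at most `t⁻²`, the path has a Lévy modulus at level `2 + log t`
(`measure_not_isRegularPath_le`). That modulus is dominated by an affine function of the increment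
tuned to the scale `√(x/t)` (`IsRegularPath.norm_sub_le`), so the first moment alone controls the
error and the integral need not be localised near `x/α`. Admissibility serves only to force `x ≥
1/t`, and one good event handles all `x` at once. -/

/-! ### Chaining: from dyadic increments to a modulus of continuity. -/

/-- Doubling the scale moves the integer part of `2 ^ m * a` by at most one dyadic step. -/
theorem floor_two_pow_succ {a : ℝ} (ha : 0 ≤ a) (m : ℕ) :
    ⌊(2 : ℝ) ^ (m + 1) * a⌋₊ = 2 * ⌊(2 : ℝ) ^ m * a⌋₊ ∨
      ⌊(2 : ℝ) ^ (m + 1) * a⌋₊ = 2 * ⌊(2 : ℝ) ^ m * a⌋₊ + 1 := by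
  have h0 : 0 ≤ (2 : ℝ) ^ m * a := by positivity
  rw [show (2 : ℝ) ^ (m + 1) * a = 2 * ((2 : ℝ) ^ m * a) by ring]
  generalize (2 : ℝ) ^ m * a = y at *
  have h1 := Nat.floor_le h0
  have h2 := Nat.lt_floor_add_one y
  have h3 := Nat.floor_le (mul_nonneg zero_le_two h0)
  have h4 := Nat.lt_floor_add_one (2 * y)
  have h5 : ((2 * ⌊y⌋₊ : ℕ) : ℝ) < ((⌊2 * y⌋₊ + 1 : ℕ) : ℝ) := by
    push_cast; linarith
  have h6 : (⌊2 * y⌋₊ : ℝ) < ((2 * ⌊y⌋₊ + 2 : ℕ) : ℝ) := by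
    push_cast; linarith
  rw [Nat.cast_lt] at h5 h6
  omega

/-- Telescoping: decay by 9/10 gives `D (m + 1) ≤ 9 * (D m - D (m + 1))`, so each refinement step is
paid for by the drop in `D`. -/
theorem dyadic_chain {f : ℝ → ℝ} {D : ℕ → ℝ} (hD0 : ∀ n, 0 ≤ D n)
    (hD : ∀ n, D (n + 1) ≤ 9 / 10 * D n)
    (hf : ∀ n j : ℕ, j < 2 ^ n → |f ((j + 1 : ℕ) / 2 ^ n) - f (j / 2 ^ n)| ≤ D n)
    {a : ℝ} (ha : a ∈ Set.Icc (0 : ℝ) 1) (n k : ℕ) :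
    |f (⌊(2 : ℝ) ^ (n + k) * a⌋₊ / 2 ^ (n + k)) - f (⌊(2 : ℝ) ^ n * a⌋₊ / 2 ^ n)| ≤
      9 * (D n - D (n + k)) := by
  induction k with
  | zero => simp
  | succ k ih =>
    set m := n + k with hm
    have hstep : |f (⌊(2 : ℝ) ^ (m + 1) * a⌋₊ / 2 ^ (m + 1)) - f (⌊(2 : ℝ) ^ m * a⌋₊ / 2 ^ m)| ≤
        D (m + 1) := by
      have hbase : (⌊(2 : ℝ) ^ m * a⌋₊ : ℝ) / 2 ^ m =
          (2 * ⌊(2 : ℝ) ^ m * a⌋₊ : ℕ) / 2 ^ (m + 1) := by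
        push_cast; rw [pow_succ]; field_simp
      rw [hbase]
      rcases floor_two_pow_succ ha.1 m with h | h
      · rw [h]; simpa using hD0 (m + 1)
      · have hle : ⌊(2 : ℝ) ^ (m + 1) * a⌋₊ ≤ 2 ^ (m + 1) := by
          apply Nat.floor_le_of_le
          push_cast
          exact mul_le_of_le_one_right (by positivity) ha.2
        rw [h] at hle ⊢
        exact hf (m + 1) _ (by omega)
    have h1 := hD m
    have h2 := abs_sub_le (f (⌊(2 : ℝ) ^ (m + 1) * a⌋₊ / 2 ^ (m + 1)))
      (f (⌊(2 : ℝ) ^ m * a⌋₊ / 2 ^ m)) (f (⌊(2 : ℝ) ^ n * a⌋₊ / 2 ^ n))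
    have h3 : n + (k + 1) = m + 1 := by omega
    rw [h3]
    linarith

theorem dyadic_approx {f : ℝ → ℝ} (hcont : Continuous f) {D : ℕ → ℝ} (hD0 : ∀ n, 0 ≤ D n)
    (hD : ∀ n, D (n + 1) ≤ 9 / 10 * D n)
    (hf : ∀ n j : ℕ, j < 2 ^ n → |f ((j + 1 : ℕ) / 2 ^ n) - f (j / 2 ^ n)| ≤ D n)
    {a : ℝ} (ha : a ∈ Set.Icc (0 : ℝ) 1) (n : ℕ) :
    |f a - f (⌊(2 : ℝ) ^ n * a⌋₊ / 2 ^ n)| ≤ 9 * D n := by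
  have hpow : Filter.Tendsto (fun k : ℕ => (2 : ℝ) ^ (n + k)) Filter.atTop Filter.atTop := by
    simp_rw [add_comm n]
    exact (Filter.tendsto_add_atTop_iff_nat n).2 (tendsto_pow_atTop_atTop_of_one_lt one_lt_two)
  have hlim : Filter.Tendsto (fun k : ℕ => (⌊(2 : ℝ) ^ (n + k) * a⌋₊ : ℝ) / 2 ^ (n + k))
      Filter.atTop (nhds a) := by
    have := (tendsto_nat_floor_mul_div_atTop ha.1).comp hpow
    refine this.congr fun k => ?_
    simp [mul_comm]
  have hlim2 := (((hcont.tendsto a).comp hlim).sub_const (f (⌊(2 : ℝ) ^ n * a⌋₊ / 2 ^ n))).abs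
  refine le_of_tendsto' hlim2 fun k => ?_
  have := dyadic_chain hD0 hD hf ha n k
  have := hD0 (n + k)
  simp only [Function.comp]
  linarith

theorem dyadic_modulus {f : ℝ → ℝ} (hcont : Continuous f) {D : ℕ → ℝ} (hD0 : ∀ n, 0 ≤ D n)
    (hD : ∀ n, D (n + 1) ≤ 9 / 10 * D n)
    (hf : ∀ n j : ℕ, j < 2 ^ n → |f ((j + 1 : ℕ) / 2 ^ n) - f (j / 2 ^ n)| ≤ D n)
    {a b : ℝ} (ha : a ∈ Set.Icc (0 : ℝ) 1) (hb : b ∈ Set.Icc (0 : ℝ) 1) (n : ℕ)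
    (hab : |a - b| * 2 ^ n ≤ 1) :
    |f a - f b| ≤ 19 * D n := by
  wlog h : a ≤ b generalizing a b
  · rw [abs_sub_comm]
    exact this hb ha (by rwa [abs_sub_comm]) (le_of_not_ge h)
  have hmid : |f (⌊(2 : ℝ) ^ n * b⌋₊ / 2 ^ n) - f (⌊(2 : ℝ) ^ n * a⌋₊ / 2 ^ n)| ≤ D n := by
    have hmono : ⌊(2 : ℝ) ^ n * a⌋₊ ≤ ⌊(2 : ℝ) ^ n * b⌋₊ :=
      Nat.floor_le_floor (by gcongr)
    -- The level-`n` floors differ by at most one, so one dyadic increment joins the two chains: 9 +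
    -- 1 + 9 = 19.
    have hub : ⌊(2 : ℝ) ^ n * b⌋₊ ≤ ⌊(2 : ℝ) ^ n * a⌋₊ + 1 := by
      rw [← Nat.floor_add_one (mul_nonneg (by positivity) ha.1)]
      apply Nat.floor_le_floor
      rw [abs_of_nonpos (by linarith)] at hab
      linarith
    have hle : ⌊(2 : ℝ) ^ n * b⌋₊ ≤ 2 ^ n := by
      apply Nat.floor_le_of_le
      push_cast
      exact mul_le_of_le_one_right (by positivity) hb.2
    rcases (by omega : ⌊(2 : ℝ) ^ n * b⌋₊ = ⌊(2 : ℝ) ^ n * a⌋₊ ∨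
      ⌊(2 : ℝ) ^ n * b⌋₊ = ⌊(2 : ℝ) ^ n * a⌋₊ + 1) with h | h
    · rw [h]; simpa using hD0 n
    · rw [h] at hle ⊢
      exact hf n _ (by omega)
  have h1 := dyadic_approx hcont hD0 hD hf ha n
  have h2 := dyadic_approx hcont hD0 hD hf hb n
  rw [abs_le] at *
  constructor <;> linarith [h1.1, h1.2, h2.1, h2.2, hmid.1, hmid.2]

/-- The size allowed to a Brownian increment over a dyadic interval of length `2⁻ⁿ`. -/
noncomputable def dyadicBound (ℓ : ℝ) (n : ℕ) : ℝ := 2 * √((n + ℓ) / 2 ^ n)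

theorem dyadicBound_nonneg (ℓ : ℝ) (n : ℕ) : 0 ≤ dyadicBound ℓ n := by
  unfold dyadicBound; positivity

/-- The ratio under the root is `1/2 + 1/(2(n + ℓ)) ≤ 3/4 < (9/10)²`; this is where `2 ≤ ℓ` enters.
-/
theorem dyadicBound_succ_le {ℓ : ℝ} (hℓ : 2 ≤ ℓ) (n : ℕ) :
    dyadicBound ℓ (n + 1) ≤ 9 / 10 * dyadicBound ℓ n := by
  unfold dyadicBound
  have : √(((n + 1 : ℕ) + ℓ) / 2 ^ (n + 1)) ≤ 9 / 10 * √((n + ℓ) / 2 ^ n) := by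
    rw [show (9 / 10 : ℝ) = √((9 / 10) ^ 2) from (Real.sqrt_sq (by norm_num)).symm,
      ← Real.sqrt_mul (by positivity)]
    apply Real.sqrt_le_sqrt
    rw [← mul_div_assoc, div_le_div_iff₀ (by positivity) (by positivity),
      pow_succ (2 : ℝ)]
    have : (0 : ℝ) < 2 ^ n := by positivity
    have hn : (0 : ℝ) ≤ n := by positivity
    push_cast
    nlinarith [mul_nonneg hn this.le, mul_le_mul_of_nonneg_right hℓ this.le]
  linarith

theorem modulus_of_dyadicBound {f : ℝ → ℝ} (hcont : Continuous f) {ℓ : ℝ} (hℓ : 2 ≤ ℓ)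
    (hf : ∀ n j : ℕ, j < 2 ^ n →
      |f ((j + 1 : ℕ) / 2 ^ n) - f (j / 2 ^ n)| ≤ dyadicBound ℓ n)
    {a b : ℝ} (ha : a ∈ Set.Icc (0 : ℝ) 1) (hb : b ∈ Set.Icc (0 : ℝ) 1) :
    |f a - f b| ≤ 60 * √(|a - b| * (2 * Real.log (|a - b|)⁻¹ + ℓ)) := by
  rcases eq_or_ne a b with rfl | hne
  · simp
  set h := |a - b| with hh
  have hpos : 0 < h := abs_pos.2 (sub_ne_zero.2 hne)
  have h1 : h ≤ 1 := by
    rw [hh, abs_le]; constructor <;> linarith [ha.1, ha.2, hb.1, hb.2]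
  -- The scale is chosen so that `2⁻ⁿ` is within a factor 2 of `h`. Then `log 2 > 1/2` turns `n`
  -- into `2 log h⁻¹`, and the constants multiply to 19 · 2 · 3/2 = 57 ≤ 60.
  obtain ⟨n, hn1, hn2⟩ := exists_nat_pow_near (one_le_inv_iff₀.2 ⟨hpos, h1⟩) one_lt_two
  have hp : (0 : ℝ) < 2 ^ n := by positivity
  have hn1' : h * 2 ^ n ≤ 1 := by
    calc h * 2 ^ n ≤ h * h⁻¹ := by gcongr
      _ = 1 := mul_inv_cancel₀ hpos.ne'
  have hn2' : 1 ≤ 2 * h * 2 ^ n := by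
    calc 1 = h * h⁻¹ := (mul_inv_cancel₀ hpos.ne').symm
      _ ≤ h * 2 ^ (n + 1) := by gcongr
      _ = 2 * h * 2 ^ n := by ring
  have hlog : (n : ℝ) ≤ 2 * Real.log h⁻¹ := by
    have h2 := Real.log_le_log hp hn1
    rw [Real.log_pow] at h2
    have := Real.log_two_gt_d9
    nlinarith [(Nat.cast_nonneg n : (0 : ℝ) ≤ n)]
  have hmod := dyadic_modulus hcont (dyadicBound_nonneg ℓ) (dyadicBound_succ_le hℓ) hf ha hb n hn1'
  have hD : √((n + ℓ) / 2 ^ n) ≤ 3 / 2 * √(h * (2 * Real.log h⁻¹ + ℓ)) := by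
    rw [show (3 / 2 : ℝ) = √((3 / 2) ^ 2) from (Real.sqrt_sq (by norm_num)).symm,
      ← Real.sqrt_mul (by positivity)]
    apply Real.sqrt_le_sqrt
    rw [div_le_iff₀ hp]
    have hnn : (0 : ℝ) ≤ n := by positivity
    have : 0 ≤ 2 * Real.log h⁻¹ + ℓ := by linarith
    calc (n : ℝ) + ℓ ≤ (2 * Real.log h⁻¹ + ℓ) * 1 := by linarith
      _ ≤ (2 * Real.log h⁻¹ + ℓ) * (2 * h * 2 ^ n) := by gcongr
      _ ≤ _ := by nlinarith [mul_nonneg (mul_nonneg hpos.le this) hp.le]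
  unfold dyadicBound at hmod
  have := Real.sqrt_nonneg (h * (2 * Real.log h⁻¹ + ℓ))
  linarith

/-! ### Gaussian tails and the probability of a large dyadic increment. -/

theorem hasSubgaussianMGF_of_hasLaw_gaussianReal {Ω : Type*} [MeasurableSpace Ω] {P : Measure Ω}
    {X : Ω → ℝ} {v : ℝ≥0} (hX : HasLaw X (gaussianReal 0 v) P) : HasSubgaussianMGF X v P where
  integrable_exp_mul t := by
    have h : Integrable (fun x => Real.exp (t * x)) (P.map X) := by
      rw [hX.map_eq]; exact integrable_exp_mul_gaussianReal t
    exact h.comp_aemeasurable hX.aemeasurable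
  mgf_le t := by rw [mgf_gaussianReal hX.map_eq]; simp

theorem measure_lt_abs_le_of_hasLaw_gaussianReal {Ω : Type*} [MeasurableSpace Ω] {P : Measure Ω}
    [IsProbabilityMeasure P] {X : Ω → ℝ} {v : ℝ≥0} (hX : HasLaw X (gaussianReal 0 v) P)
    {ε : ℝ} (hε : 0 ≤ ε) :
    P {ω | ε < |X ω|} ≤ ENNReal.ofReal (2 * Real.exp (-ε ^ 2 / (2 * v))) := by
  have hs := hasSubgaussianMGF_of_hasLaw_gaussianReal hX
  have h1 := hs.measure_ge_le hε
  have h2 := hs.neg.measure_ge_le hε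
  have hsub : {ω | ε < |X ω|} ⊆ {ω | ε ≤ X ω} ∪ {ω | ε ≤ (-X) ω} := by
    intro ω hω
    rcases lt_abs.1 (Set.mem_ofPred.1 hω) with h | h
    · exact Or.inl h.le
    · exact Or.inr h.le
  have hreal : P.real {ω | ε < |X ω|} ≤ 2 * Real.exp (-ε ^ 2 / (2 * v)) :=
    (measureReal_mono hsub).trans ((measureReal_union_le _ _).trans (by linarith))
  rw [← ofReal_measureReal]
  exact ENNReal.ofReal_le_ofReal hreal

/-- The paths having a dyadic increment over `[0, 1]` that exceeds `dyadicBound ℓ`. -/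
def dyadicBad {Ω : Type*} (B : ℝ≥0 → Ω → ℝ) (ℓ : ℝ) : Set Ω :=
  {ω | ∃ n j : ℕ, j < 2 ^ n ∧ dyadicBound ℓ n <
    |B (Real.toNNReal ((j + 1 : ℕ) / 2 ^ n)) ω - B (Real.toNNReal (j / 2 ^ n)) ω|}

/-- Union bound: an increment of variance `2⁻ⁿ` fails with probability at most `2 exp(-2(n + ℓ))`,
and since `2 e⁻² ≤ 1/2` the `2ⁿ` intervals of each level leave a geometric series. -/
theorem measure_dyadicBad_le {Ω : Type*} [MeasurableSpace Ω] {P : Measure Ω}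
    [IsProbabilityMeasure P] {B : ℝ≥0 → Ω → ℝ} (hB : IsPreBrownianReal B P) {ℓ : ℝ} (hℓ : 0 ≤ ℓ) :
    P (dyadicBad B ℓ) ≤ ENNReal.ofReal (4 * Real.exp (-2 * ℓ)) := by
  have hinc (n j : ℕ) : P {ω | dyadicBound ℓ n <
      |B (Real.toNNReal ((j + 1 : ℕ) / 2 ^ n)) ω - B (Real.toNNReal (j / 2 ^ n)) ω|} ≤
      ENNReal.ofReal (2 * Real.exp (-2 * (n + ℓ))) := by
    refine (measure_lt_abs_le_of_hasLaw_gaussianReal (hB.hasLaw_sub _ _)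
      (dyadicBound_nonneg ℓ n)).trans (ENNReal.ofReal_le_ofReal (le_of_eq ?_))
    congr 2
    have hd : ((nndist (Real.toNNReal ((j + 1 : ℕ) / 2 ^ n)).1
        (Real.toNNReal ((j : ℝ) / 2 ^ n)).1 : ℝ≥0) : ℝ) = (2 ^ n)⁻¹ := by
      change dist (Real.toNNReal ((j + 1 : ℕ) / 2 ^ n) : ℝ) (Real.toNNReal ((j : ℝ) / 2 ^ n) : ℝ) = _
      rw [Real.coe_toNNReal _ (by positivity), Real.coe_toNNReal _ (by positivity), Real.dist_eq,
        ← sub_div]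
      push_cast
      rw [add_sub_cancel_left, abs_of_pos (by positivity), one_div]
    rw [hd, dyadicBound, mul_pow, Real.sq_sqrt (by positivity)]
    field_simp
  have hsub : dyadicBad B ℓ ⊆ ⋃ n : ℕ, ⋃ j ∈ Finset.range (2 ^ n), {ω | dyadicBound ℓ n <
      |B (Real.toNNReal ((j + 1 : ℕ) / 2 ^ n)) ω - B (Real.toNNReal (j / 2 ^ n)) ω|} := by
    rintro ω ⟨n, j, hj, h⟩
    simp only [Set.mem_iUnion, Finset.mem_range]
    exact ⟨n, j, hj, h⟩
  have hlevel (n : ℕ) : P (⋃ j ∈ Finset.range (2 ^ n), {ω | dyadicBound ℓ n <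
      |B (Real.toNNReal ((j + 1 : ℕ) / 2 ^ n)) ω - B (Real.toNNReal (j / 2 ^ n)) ω|}) ≤
      ENNReal.ofReal (2 * Real.exp (-2 * ℓ) * (1 / 2) ^ n) := by
    refine (measure_biUnion_finset_le _ _).trans ?_
    refine (Finset.sum_le_sum fun j _ => hinc n j).trans ?_
    rw [Finset.sum_const, Finset.card_range, nsmul_eq_mul, ← ENNReal.ofReal_natCast,
      ← ENNReal.ofReal_mul (by positivity)]
    apply ENNReal.ofReal_le_ofReal
    have he : 2 * Real.exp (-2) ≤ 1 / 2 := by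
      have h1 : (2 : ℝ) ≤ Real.exp 1 := by have := Real.exp_one_gt_d9; linarith
      have h2 : (4 : ℝ) ≤ Real.exp 2 := by
        rw [show (2 : ℝ) = 1 + 1 by norm_num, Real.exp_add]; nlinarith
      rw [Real.exp_neg, ← div_eq_mul_inv, div_le_div_iff₀ (by positivity) (by norm_num)]
      linarith
    have hexp : Real.exp (-2 * (n + ℓ)) = Real.exp (-2) ^ n * Real.exp (-2 * ℓ) := by
      rw [← Real.exp_nat_mul, ← Real.exp_add]; ring_nf
    rw [hexp]
    calc ((2 ^ n : ℕ) : ℝ) * (2 * (Real.exp (-2) ^ n * Real.exp (-2 * ℓ)))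
        = 2 * Real.exp (-2 * ℓ) * (2 * Real.exp (-2)) ^ n := by push_cast; rw [mul_pow]; ring
      _ ≤ _ := by gcongr
  refine (measure_mono hsub).trans ((measure_iUnion_le _).trans ?_)
  refine (ENNReal.tsum_le_tsum hlevel).trans ?_
  rw [← ENNReal.ofReal_tsum_of_nonneg (fun n => by positivity)
    (summable_geometric_two.mul_left _), tsum_mul_left, tsum_geometric_two]
  apply ENNReal.ofReal_le_ofReal
  linarith

/-! ### Regularity of Brownian paths at level `2 + log t`. -/

/-- Regular planar paths: continuous, started at `0`, with a Lévy type modulus of continuity on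
the unit interval, at level `ℓ`. -/
structure IsRegularPath (w : ℝ≥0 → EuclideanSpace ℝ (Fin 2)) (ℓ : ℝ) : Prop where
  cont : Continuous w
  zero : w 0 = 0
  modulus : ∀ a ∈ Set.Icc (0 : ℝ) 1, ∀ b ∈ Set.Icc (0 : ℝ) 1,
    ‖w (Real.toNNReal a) - w (Real.toNNReal b)‖ ≤
      120 * √(|a - b| * (2 * Real.log (|a - b|)⁻¹ + ℓ))

theorem IsRegularPath.mono {w : ℝ≥0 → EuclideanSpace ℝ (Fin 2)} {ℓ ℓ' : ℝ}
    (hw : IsRegularPath w ℓ) (h : ℓ ≤ ℓ') : IsRegularPath w ℓ' where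
  cont := hw.cont
  zero := hw.zero
  modulus a ha b hb := (hw.modulus a ha b hb).trans (by gcongr)

theorem isRegularPath_of_notMem_dyadicBad {Ω : Type*} {W : ℝ≥0 → Ω → EuclideanSpace ℝ (Fin 2)}
    {ℓ : ℝ} (hℓ : 2 ≤ ℓ) {ω : Ω} (hc : ∀ i, Continuous fun t => W t ω i) (h0 : ∀ i, W 0 ω i = 0)
    (hg : ∀ i, ω ∉ dyadicBad (fun t ω => W t ω i) ℓ) : IsRegularPath (fun t => W t ω) ℓ where
  cont := by
    have h : Continuous fun t => (WithLp.toLp 2 (fun i => W t ω i) : EuclideanSpace ℝ (Fin 2)) :=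
      (PiLp.continuous_toLp 2 _).comp (continuous_pi hc)
    exact h
  zero := by ext i; simpa using h0 i
  modulus a ha b hb := by
    have key (i : Fin 2) := modulus_of_dyadicBound (f := fun s => W (Real.toNNReal s) ω i)
      ((hc i).comp continuous_real_toNNReal) hℓ (fun n j hj => by
        by_contra hcon
        exact hg i ⟨n, j, hj, not_le.1 hcon⟩) ha hb
    have hnorm (v : EuclideanSpace ℝ (Fin 2)) : ‖v‖ ≤ |v 0| + |v 1| := by
      rw [EuclideanSpace.norm_eq, Fin.sum_univ_two]
      apply Real.sqrt_le_iff.2 ⟨by positivity, ?_⟩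
      simp only [Real.norm_eq_abs]
      nlinarith [mul_nonneg (abs_nonneg (v 0)) (abs_nonneg (v 1))]
    have h := hnorm (W (Real.toNNReal a) ω - W (Real.toNNReal b) ω)
    have k0 := key 0
    have k1 := key 1
    simp only [PiLp.sub_apply] at h
    linarith

theorem measure_not_isRegularPath_le {Ω : Type*} [MeasurableSpace Ω] {P : Measure Ω}
    [IsProbabilityMeasure P] {W : ℝ≥0 → Ω → EuclideanSpace ℝ (Fin 2)} (hW : IsPlanarBrownian W P)
    {t : ℝ} (ht : 1 ≤ t) :
    P {ω | ¬ IsRegularPath (fun s => W s ω) (2 + Real.log t)} ≤ ENNReal.ofReal (t ^ (-2 : ℝ)) := by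
  have hlog := Real.log_nonneg ht
  set ℓ := 2 + Real.log t with hℓ
  have hnull : ∀ᵐ ω ∂P, (∀ i, Continuous fun t => W t ω i) ∧ ∀ i, W 0 ω i = 0 :=
    (ae_all_iff.2 fun i => (hW.coord i).cont).and
      (ae_all_iff.2 fun i => (hW.coord i).eval_zero_ae_eq_zero)
  have hle : P {ω | ¬ IsRegularPath (fun s => W s ω) ℓ} ≤
      P (dyadicBad (fun t ω => W t ω 0) ℓ ∪ dyadicBad (fun t ω => W t ω 1) ℓ) := by
    refine measure_mono_ae ?_
    filter_upwards [hnull] with ω hω hbad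
    by_contra hcon
    refine hbad (isRegularPath_of_notMem_dyadicBad (by linarith) hω.1 hω.2 fun i => ?_)
    fin_cases i
    · exact fun h => hcon (Or.inl h)
    · exact fun h => hcon (Or.inr h)
  refine hle.trans ((measure_union_le _ _).trans ?_)
  have hB (i : Fin 2) := measure_dyadicBad_le (hW.coord i).toIsPreBrownianReal
    (ℓ := ℓ) (by linarith)
  refine (add_le_add (hB 0) (hB 1)).trans ?_
  rw [← ENNReal.ofReal_add (by positivity) (by positivity)]
  apply ENNReal.ofReal_le_ofReal
  have hexp : Real.exp (-2 * ℓ) = Real.exp (-4) * t ^ (-2 : ℝ) := by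
    rw [Real.rpow_def_of_pos (by linarith), ← Real.exp_add, hℓ]; ring_nf
  -- Two coordinates at cost 4 each; the summand 2 in the level supplies the factor `e⁻⁴` that
  -- absorbs them.
  have he : 8 * Real.exp (-4) ≤ 1 := by
    have h1 : (2 : ℝ) ≤ Real.exp 1 := by have := Real.exp_one_gt_d9; linarith
    have h2 : (8 : ℝ) ≤ Real.exp 4 := by
      calc (8 : ℝ) ≤ 2 ^ 4 := by norm_num
        _ ≤ Real.exp 1 ^ 4 := by gcongr
        _ = Real.exp 4 := by rw [← Real.exp_nat_mul]; norm_num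
    rw [Real.exp_neg, ← div_eq_mul_inv, div_le_one (by positivity)]
    exact h2
  rw [hexp]
  have : 0 < t ^ (-2 : ℝ) := Real.rpow_pos_of_pos (by linarith) _
  nlinarith

/-- Regularity is monotone in the level, so being regular at one `t` gives it at all later times.
The exceptional set thus lies in a set of measure at most `t⁻²` for every `t ≥ 1`, and no
Borel–Cantelli argument or discretisation of time is needed. -/
theorem ae_eventually_isRegularPath {Ω : Type*} [MeasurableSpace Ω] {P : Measure Ω}
    [IsProbabilityMeasure P] {W : ℝ≥0 → Ω → EuclideanSpace ℝ (Fin 2)}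
    (hW : IsPlanarBrownian W P) :
    ∀ᵐ ω ∂P, ∃ T : ℝ, 0 < T ∧ ∀ t : ℝ, T ≤ t →
      IsRegularPath (fun s => W s ω) (2 + Real.log t) := by
  rw [ae_iff]
  have hlim : Filter.Tendsto (fun t : ℝ => ENNReal.ofReal (t ^ (-2 : ℝ))) Filter.atTop
      (nhds 0) := by
    simpa using ENNReal.tendsto_ofReal (tendsto_rpow_neg_atTop (y := 2) (by norm_num))
  refine le_antisymm (ge_of_tendsto hlim ?_) zero_le
  filter_upwards [Filter.eventually_ge_atTop 1] with t ht
  refine (measure_mono ?_).trans (measure_not_isRegularPath_le hW ht)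
  intro ω hω hreg
  exact hω ⟨t, by linarith, fun s hs => hreg.mono (by gcongr)⟩

/-! ### The kernel as a pullback of the Gaussian density, and its first moment. -/

/-- The standardising change of variables `s ↦ (α s - x) / (σ √s)`: it pushes the smoothing kernel
forward to the standard Gaussian density. -/
noncomputable def congaScore (α σ x s : ℝ) : ℝ := (α * s - x) / (σ * √s)

section Score

variable {α σ x : ℝ}

theorem hasDerivAt_congaScore (hσ : 0 < σ) {s : ℝ} (hs : 0 < s) :
    HasDerivAt (congaScore α σ x) ((x + α * s) / (2 * σ * s ^ (3 / 2 : ℝ))) s := by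
  have hq : 0 < √s := Real.sqrt_pos.2 hs
  have h1 : HasDerivAt (fun s => α * s - x) α s := by
    simpa using ((hasDerivAt_id s).const_mul α).sub_const x
  have h2 : HasDerivAt (fun s => σ * √s) (σ * (1 / (2 * √s))) s :=
    (Real.hasDerivAt_sqrt hs.ne').const_mul σ
  have h3 := h1.div h2 (by positivity)
  have hpow : s ^ (3 / 2 : ℝ) = √s ^ 3 := by
    rw [Real.sqrt_eq_rpow, ← Real.rpow_natCast, ← Real.rpow_mul hs.le]; norm_num
  have hsq : √s ^ 2 = s := Real.sq_sqrt hs.le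
  convert! h3 using 1
  rw [hpow]
  generalize √s = q at *
  subst hsq
  field_simp
  ring

theorem strictMonoOn_congaScore (hα : 0 < α) (hσ : 0 < σ) (hx : 0 < x) :
    StrictMonoOn (congaScore α σ x) (Set.Ioi 0) := by
  refine strictMonoOn_of_deriv_pos (convex_Ioi 0)
    (fun s hs => (hasDerivAt_congaScore hσ hs).continuousAt.continuousWithinAt) fun s hs => ?_
  rw [interior_Ioi] at hs
  have hs' : 0 < s := hs
  rw [(hasDerivAt_congaScore hσ hs').deriv]
  positivity

theorem image_congaScore (hα : 0 < α) (hσ : 0 < σ) (hx : 0 < x) :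
    congaScore α σ x '' Set.Ioi 0 = Set.univ := by
  refine Set.eq_univ_of_forall fun y => ?_
  -- The preimage of `y` is `z²`, with `z` the positive root of `α z² - σ y z - x = 0`.
  set d := √((σ * y) ^ 2 + 4 * α * x) with hd
  have hd2 : d ^ 2 = (σ * y) ^ 2 + 4 * α * x := Real.sq_sqrt (by positivity)
  have hdy : |σ * y| < d := by
    rw [hd, ← Real.sqrt_sq_eq_abs]
    exact Real.sqrt_lt_sqrt (sq_nonneg _) (by linarith [mul_pos hα hx])
  set z := (σ * y + d) / (2 * α) with hz
  have hz0 : 0 < z := div_pos (by linarith [(abs_lt.1 hdy).1, neg_abs_le (σ * y)]) (by positivity)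
  have hzz : 2 * α * z = σ * y + d := by rw [hz]; field_simp
  refine ⟨z ^ 2, Set.mem_Ioi.2 (by positivity), ?_⟩
  rw [congaScore, Real.sqrt_sq hz0.le, div_eq_iff (by positivity)]
  have : 4 * α * (α * z ^ 2 - x) = 4 * α * (y * (σ * z)) := by
    have h4 : d = 2 * α * z - σ * y := by linarith
    rw [h4] at hd2
    linarith
  exact mul_left_cancel₀ (by positivity) this

/-- By definition of the score, `s - x/α = σ √s y / α`, and the quadratic equation for `√s` yields
`α √s ≤ σ |y| + √(α x)`. -/
theorem abs_sub_mean_le (hα : 0 < α) (hσ : 0 < σ) (hx : 0 < x) {s : ℝ} (hs : 0 < s) :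
    |s - x / α| ≤ (σ ^ 2 / α ^ 2 + σ * √(α * x) / α ^ 2) * congaScore α σ x s ^ 2 +
      σ * √(α * x) / α ^ 2 := by
  set y := congaScore α σ x s with hy
  set q := √s with hq
  have hq0 : 0 < q := Real.sqrt_pos.2 hs
  have hqs : q ^ 2 = s := Real.sq_sqrt hs.le
  have hrel : α * s - x = σ * q * y := by rw [hy, congaScore, ← hq]; field_simp
  set e := √(α * x) with he
  have he0 : 0 < e := Real.sqrt_pos.2 (by positivity)
  have he2 : e ^ 2 = α * x := Real.sq_sqrt (by positivity)
  have hyabs : 0 ≤ |y| := abs_nonneg y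
  have hqb : α * q ≤ σ * |y| + e := by
    by_contra hcon
    push Not at hcon
    have h1 : (α * q) ^ 2 = α * σ * q * y + e ^ 2 := by
      rw [he2, mul_pow, hqs]; linear_combination α * hrel
    have h2 : α * σ * q * y ≤ α * q * (σ * |y|) := by
      have := mul_le_mul_of_nonneg_left (le_abs_self y) (by positivity : 0 ≤ α * σ * q)
      linarith
    have h3 : 0 ≤ σ * |y| := by positivity
    nlinarith [mul_pos hα hq0]
  have habs : |s - x / α| = σ * q * |y| / α := by
    rw [show s - x / α = σ * q * y / α by rw [← hrel]; field_simp, abs_div, abs_mul,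
      abs_of_pos hα, abs_of_pos (mul_pos hσ hq0)]
  have hsq : |y| ^ 2 = y ^ 2 := sq_abs y
  rw [habs, ← hsq]
  -- Trading `|y|` for `y² + 1` leaves only the Gaussian mass and variance to integrate.
  have hy1 : |y| ≤ |y| ^ 2 + 1 := by nlinarith [sq_nonneg (|y| - 1)]
  calc σ * q * |y| / α = (α * q) * (σ * |y|) / α ^ 2 := by field_simp
    _ ≤ (σ * |y| + e) * (σ * |y|) / α ^ 2 := by gcongr
    _ = σ ^ 2 / α ^ 2 * |y| ^ 2 + σ * e / α ^ 2 * |y| := by ring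
    _ ≤ σ ^ 2 / α ^ 2 * |y| ^ 2 + σ * e / α ^ 2 * (|y| ^ 2 + 1) := by gcongr
    _ = _ := by ring

end Score

theorem integrable_gaussianPDFReal_mul_sq :
    Integrable (fun y : ℝ => gaussianPDFReal 0 1 y * y ^ 2) ∧
      ∫ y : ℝ, gaussianPDFReal 0 1 y * y ^ 2 = 1 := by
  have hvar : ∫ y : ℝ, gaussianPDFReal 0 1 y * y ^ 2 = 1 := by
    have h1 := variance_fun_id_gaussianReal (μ := 0) (v := 1)
    rw [variance_eq_integral aemeasurable_id', integral_id_gaussianReal,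
      integral_gaussianReal_eq_integral_smul one_ne_zero] at h1
    simpa using h1
  refine ⟨?_, hvar⟩
  -- A non-integrable function has Bochner integral 0, which contradicts the value 1.
  by_contra hcon
  rw [integral_undef hcon] at hvar
  exact zero_ne_one hvar

section Kernel

variable {α t x : ℝ}

theorem congaKernel_eq (hσ : 0 < congaSigma α t) {s : ℝ} (hs : 0 < s) :
    congaKernel α t x s = (x + α * s) / (2 * congaSigma α t * s ^ (3 / 2 : ℝ)) *
      gaussianPDFReal 0 1 (congaScore α (congaSigma α t) x s) := by
  have hsq : √s ^ 2 = s := Real.sq_sqrt hs.le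
  have hq : 0 < √s := Real.sqrt_pos.2 hs
  have he : -(x - α * s) ^ 2 / (2 * congaSigma α t ^ 2 * s) =
      -((α * s - x) / (congaSigma α t * √s) - 0) ^ 2 / (2 * ((1 : ℝ≥0) : ℝ)) := by
    rw [sub_zero, div_pow, mul_pow, hsq]
    push_cast
    field_simp
    ring_nf
  rw [congaKernel, gaussianPDFReal, congaScore, he]
  push_cast
  rw [mul_one]
  ring_nf

theorem integrableOn_congaKernel_mul (hα : 0 < α) (hσ : 0 < congaSigma α t) (hx : 0 < x)
    {g : ℝ → ℝ} (hg : Integrable fun y => gaussianPDFReal 0 1 y * g y) :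
    IntegrableOn (fun s => congaKernel α t x s * g (congaScore α (congaSigma α t) x s))
      (Set.Ioi 0) ∧
    ∫ s in Set.Ioi 0, congaKernel α t x s * g (congaScore α (congaSigma α t) x s) =
      ∫ y, gaussianPDFReal 0 1 y * g y := by
  have hd : ∀ s ∈ Set.Ioi (0 : ℝ), HasDerivWithinAt (congaScore α (congaSigma α t) x)
      ((x + α * s) / (2 * congaSigma α t * s ^ (3 / 2 : ℝ))) (Set.Ioi 0) s :=
    fun s hs => (hasDerivAt_congaScore hσ hs).hasDerivWithinAt
  have hm := (strictMonoOn_congaScore hα hσ hx).monotoneOn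
  have heq : Set.EqOn (fun s => congaKernel α t x s * g (congaScore α (congaSigma α t) x s))
      (fun s => ((x + α * s) / (2 * congaSigma α t * s ^ (3 / 2 : ℝ))) •
        (gaussianPDFReal 0 1 (congaScore α (congaSigma α t) x s) *
          g (congaScore α (congaSigma α t) x s))) (Set.Ioi 0) := by
    intro s hs
    simp only [congaKernel_eq hσ hs, smul_eq_mul, mul_assoc]
  constructor
  · rw [integrableOn_congr_fun heq measurableSet_Ioi,
      ← integrableOn_image_iff_integrableOn_deriv_smul_of_monotoneOn measurableSet_Ioi hd hm
        (fun y => gaussianPDFReal 0 1 y * g y), image_congaScore hα hσ hx, integrableOn_univ]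
    exact hg
  · rw [setIntegral_congr_fun measurableSet_Ioi heq,
      ← integral_image_eq_integral_deriv_smul_of_monotoneOn measurableSet_Ioi hd hm
        (fun y => gaussianPDFReal 0 1 y * g y), image_congaScore hα hσ hx, setIntegral_univ]

theorem congaKernel_nonneg (hα : 0 < α) (hσ : 0 < congaSigma α t) (hx : 0 < x) {s : ℝ}
    (hs : 0 < s) : 0 ≤ congaKernel α t x s := by
  unfold congaKernel; positivity

theorem integrableOn_congaKernel (hα : 0 < α) (hσ : 0 < congaSigma α t) (hx : 0 < x) :
    IntegrableOn (congaKernel α t x) (Set.Ioi 0) ∧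
      ∫ s in Set.Ioi 0, congaKernel α t x s = 1 := by
  have h := integrableOn_congaKernel_mul hα hσ hx (g := fun _ => 1)
    (by simpa using integrable_gaussianPDFReal 0 1)
  simpa [integral_gaussianPDFReal_eq_one] using h

theorem integrableOn_congaKernel_mul_abs (hα : 0 < α) (hσ : 0 < congaSigma α t) (hx : 0 < x) :
    IntegrableOn (fun s => congaKernel α t x s * |s - x / α|) (Set.Ioi 0) ∧
      ∫ s in Set.Ioi 0, congaKernel α t x s * |s - x / α| ≤
        congaSigma α t ^ 2 / α ^ 2 + 2 * (congaSigma α t * √(α * x) / α ^ 2) := by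
  set σ := congaSigma α t
  set A := σ ^ 2 / α ^ 2 + σ * √(α * x) / α ^ 2
  set B := σ * √(α * x) / α ^ 2
  obtain ⟨hi2, hv2⟩ := integrable_gaussianPDFReal_mul_sq
  have hfun : (fun y : ℝ => gaussianPDFReal 0 1 y * (A * y ^ 2 + B)) =
      fun y => A * (gaussianPDFReal 0 1 y * y ^ 2) + B * gaussianPDFReal 0 1 y := by
    ext y; ring
  have hiA := hi2.const_mul A
  have hiB := (integrable_gaussianPDFReal 0 1).const_mul B
  obtain ⟨hi, hv⟩ := integrableOn_congaKernel_mul hα hσ hx (g := fun y => A * y ^ 2 + B)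
    (by rw [hfun]; exact hiA.add hiB)
  rw [hfun, integral_add hiA hiB, integral_const_mul, integral_const_mul, hv2,
    integral_gaussianPDFReal_eq_one _ one_ne_zero] at hv
  have hle : ∀ s ∈ Set.Ioi (0 : ℝ), congaKernel α t x s * |s - x / α| ≤
      congaKernel α t x s * (A * congaScore α σ x s ^ 2 + B) := fun s hs =>
    mul_le_mul_of_nonneg_left (abs_sub_mean_le hα hσ hx hs) (congaKernel_nonneg hα hσ hx hs)
  have hint : IntegrableOn (fun s => congaKernel α t x s * |s - x / α|) (Set.Ioi 0) := by
    refine hi.mono' ?_ ?_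
    · exact (integrableOn_congaKernel hα hσ hx).1.aestronglyMeasurable.mul
        (by fun_prop : Continuous fun s : ℝ => |s - x / α|).aestronglyMeasurable
    · refine (ae_restrict_iff' measurableSet_Ioi).2 (ae_of_all _ fun s hs => ?_)
      rw [Real.norm_of_nonneg (mul_nonneg (congaKernel_nonneg hα hσ hx hs) (abs_nonneg _))]
      exact hle s hs
  refine ⟨hint, (setIntegral_mono_on hint hi measurableSet_Ioi hle).trans ?_⟩
  rw [hv]
  simp only [A, B]
  linarith

/-- Unit mass allows the constant `c` to be moved inside the integral; the affine bound then
integrates to `p` times the first moment plus `q`. -/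
theorem congaError_le_of_linear_bound (hα : 0 < α) (hσ : 0 < congaSigma α t) (hx : 0 < x)
    {w : ℝ≥0 → EuclideanSpace ℝ (Fin 2)} (hw : Continuous w) (hw0 : w 0 = 0) {p q : ℝ}
    (hp : 0 ≤ p) (hbound : ∀ s, 0 < s →
      ‖w (Real.toNNReal (1 - s)) - w (Real.toNNReal (1 - x / α))‖ ≤ p * |s - x / α| + q) :
    congaError α t w x ≤
      p * (congaSigma α t ^ 2 / α ^ 2 + 2 * (congaSigma α t * √(α * x) / α ^ 2)) + q := by
  obtain ⟨hk, hk1⟩ := integrableOn_congaKernel hα hσ hx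
  obtain ⟨hka, hka1⟩ := integrableOn_congaKernel_mul_abs hα hσ hx
  set k := congaKernel α t x
  set c := w (Real.toNNReal (1 - x / α)) with hc
  have hdom : IntegrableOn (fun s => p * (k s * |s - x / α|) + q * k s) (Set.Ioi 0) :=
    (hka.const_mul p).add (hk.const_mul q)
  have hptw : ∀ s ∈ Set.Ioi (0 : ℝ), ‖k s • (w (Real.toNNReal (1 - s)) - c)‖ ≤
      p * (k s * |s - x / α|) + q * k s := by
    intro s hs
    have hks := congaKernel_nonneg hα hσ hx hs (t := t)
    rw [norm_smul, Real.norm_of_nonneg hks]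
    calc k s * _ ≤ k s * (p * |s - x / α| + q) :=
          mul_le_mul_of_nonneg_left (hbound s hs) hks
      _ = _ := by ring
  have hptw' := (ae_restrict_iff' (μ := volume) measurableSet_Ioi).2 (ae_of_all _ hptw)
  have hcont : Continuous fun s : ℝ => w (Real.toNNReal (1 - s)) - c :=
    (hw.comp (continuous_real_toNNReal.comp (by fun_prop))).sub continuous_const
  have hdiff : IntegrableOn (fun s => k s • (w (Real.toNNReal (1 - s)) - c)) (Set.Ioi 0) :=
    hdom.mono' (hk.aestronglyMeasurable.smul hcont.aestronglyMeasurable) hptw'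
  have hkc : IntegrableOn (fun s => k s • c) (Set.Ioi 0) := hk.smul_const c
  have hu : scaledConga α t w x = ∫ s in Set.Ioi 0, k s • w (Real.toNNReal (1 - s)) := by
    rw [scaledConga, intervalIntegral.integral_of_le zero_le_one]
    symm
    -- For `s ≥ 1` the truncated time is 0, where the path vanishes, so the domain extends to `(0,
    -- ∞)` for free.
    refine setIntegral_eq_of_subset_of_forall_sdiff_eq_zero measurableSet_Ioi
      Set.Ioc_subset_Ioi_self fun s hs => ?_
    have hs1 : 1 ≤ s := by
      by_contra hcon
      exact hs.2 ⟨hs.1, (not_le.1 hcon).le⟩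
    rw [Real.toNNReal_of_nonpos (by linarith), hw0, smul_zero]
  have hsplit : scaledConga α t w x - c =
      ∫ s in Set.Ioi 0, k s • (w (Real.toNNReal (1 - s)) - c) := by
    have h1 : scaledConga α t w x =
        ∫ s in Set.Ioi 0, (k s • (w (Real.toNNReal (1 - s)) - c) + k s • c) := by
      rw [hu]
      refine integral_congr_ae (ae_of_all _ fun s => ?_)
      simp only [smul_sub, sub_add_cancel]
    rw [h1, integral_add hdiff hkc, integral_smul_const, hk1, one_smul, add_sub_cancel_right]
  rw [congaError, ← hc, hsplit]
  refine (norm_integral_le_of_norm_le hdom hptw').trans ?_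
  rw [integral_add (hka.const_mul p) (hk.const_mul q), integral_const_mul, integral_const_mul, hk1,
    mul_one]
  gcongr

end Kernel

/-! ### Tuning the affine bound, and the deterministic error estimate. -/

section Estimate

variable {α t x : ℝ}

theorem congaRate_eq (t x : ℝ) : congaRate t x = √(√(x / t) * Real.log (t / x)) := by
  rw [congaRate, Real.sqrt_eq_rpow (x / t), ← inv_div t x, Real.log_inv]
  ring_nf

/-- The concave function `h log h⁻¹` lies below its tangent at `m`; the tangent's `-h` term is
dropped. -/
theorem mul_log_inv_le {h m : ℝ} (hh : 0 ≤ h) (hm : 0 < m) :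
    h * Real.log h⁻¹ ≤ h * Real.log m⁻¹ + m := by
  rcases hh.eq_or_lt with rfl | hh
  · simpa using hm.le
  have h1 := Real.log_le_sub_one_of_pos (div_pos hm hh)
  rw [Real.log_div hm.ne' hh.ne'] at h1
  have h2 : h * (Real.log m - Real.log h) ≤ h * (m / h - 1) := by gcongr
  have h3 : h * (m / h - 1) = m - h := by field_simp
  rw [Real.log_inv, Real.log_inv]
  linarith

/-- At level `2 + log t`, the modulus of continuity of a regular path is bounded by an affine
function of the increment, tuned to the scale `√(x / t)`. -/
theorem IsRegularPath.norm_sub_le {w : ℝ≥0 → EuclideanSpace ℝ (Fin 2)}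
    (hw : IsRegularPath w (2 + Real.log t)) (ht : Real.exp 2 ≤ t) (hx : 0 < x) (hx1 : x ≤ 1)
    {a b : ℝ} (ha : a ∈ Set.Icc (0 : ℝ) 1) (hb : b ∈ Set.Icc (0 : ℝ) 1) :
    ‖w (Real.toNNReal a) - w (Real.toNNReal b)‖ ≤
      180 * Real.log (t / x) / congaRate t x * |a - b| + 180 * congaRate t x := by
  have ht0 : 0 < t := (Real.exp_pos 2).trans_le ht
  have hlogt : 2 ≤ Real.log t := (Real.le_log_iff_exp_le ht0).2 ht
  have hlogx : Real.log x ≤ 0 := Real.log_nonpos hx.le hx1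
  have hL' : Real.log (t / x) = Real.log t - Real.log x := Real.log_div ht0.ne' hx.ne'
  have hm : 0 < √(x / t) := Real.sqrt_pos.2 (by positivity)
  have hlogm : Real.log (√(x / t))⁻¹ = Real.log (t / x) / 2 := by
    rw [Real.log_inv, Real.log_sqrt (by positivity), ← inv_div t x, Real.log_inv]; ring
  have hr := congaRate_eq t x
  set L := Real.log (t / x)
  set m := √(x / t)
  set r := congaRate t x
  set h := |a - b| with hh
  have hh0 : 0 ≤ h := abs_nonneg _
  have hL : Real.log t ≤ L := by linarith
  have hr0 : 0 < r := by rw [hr]; exact Real.sqrt_pos.2 (mul_pos hm (by linarith))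
  have hr2 : r ^ 2 = m * L := by rw [hr]; exact Real.sq_sqrt (mul_nonneg hm.le (by linarith))
  have hpsi : h * (2 * Real.log h⁻¹ + (2 + Real.log t)) ≤ 3 * h * L + 2 * r ^ 2 := by
    have h1 := mul_log_inv_le hh0 hm
    rw [hlogm] at h1
    have h2 : h * (2 + Real.log t) ≤ h * (2 * L) := by gcongr; linarith
    have h3 : m * 1 ≤ m * L := by gcongr; linarith
    nlinarith
  have hnn : 0 ≤ 3 * h * L + 2 * r ^ 2 := by
    have : 0 ≤ L := by linarith
    positivity
  -- AM-GM with weight `r`, which linearises the square root in `h`.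
  have hsqrt : √(3 * h * L + 2 * r ^ 2) ≤ ((3 * h * L + 2 * r ^ 2) / r + r) / 2 := by
    have hs := Real.sq_sqrt hnn
    generalize √(3 * h * L + 2 * r ^ 2) = s at *
    rw [← hs, le_div_iff₀ two_pos, div_add' _ _ _ hr0.ne', le_div_iff₀ hr0]
    nlinarith [sq_nonneg (s - r)]
  calc _ ≤ 120 * √(h * (2 * Real.log h⁻¹ + (2 + Real.log t))) := hw.modulus a ha b hb
    _ ≤ 120 * √(3 * h * L + 2 * r ^ 2) := by gcongr
    _ ≤ 120 * (((3 * h * L + 2 * r ^ 2) / r + r) / 2) := by gcongr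
    _ = _ := by field_simp; ring

theorem congaSigma_moment_le (hα₀ : 0 < α) (hα₁ : α < 1) (ht : 0 < t) (hx : 1 / t ≤ x) :
    congaSigma α t ^ 2 / α ^ 2 + 2 * (congaSigma α t * √(α * x) / α ^ 2) ≤
      3 / α * √(x / t) := by
  have hx0 : 0 < x := (by positivity : (0 : ℝ) < 1 / t).trans_le hx
  have hσ2 : congaSigma α t ^ 2 = α * (1 - α) / t := by
    rw [congaSigma, div_pow, Real.sq_sqrt (by nlinarith), Real.sq_sqrt ht.le]
  -- The hypothesis `1/t ≤ x` makes the `σ²` term, of order `1/t`, no larger than the main term.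
  have hm : 1 / t ≤ √(x / t) := by
    apply Real.le_sqrt_of_sq_le
    rw [sq, mul_one_div]
    gcongr
  have h1 : congaSigma α t ^ 2 / α ^ 2 ≤ 1 / α * √(x / t) := by
    rw [hσ2]
    calc α * (1 - α) / t / α ^ 2 = (1 - α) / α * (1 / t) := by field_simp
      _ ≤ 1 / α * √(x / t) := by gcongr; linarith
  have h2 : congaSigma α t * √(α * x) ≤ α * √(x / t) := by
    rw [congaSigma, ← Real.sqrt_div (by nlinarith), ← Real.sqrt_mul (by
      apply div_nonneg _ ht.le; nlinarith)]
    refine Real.sqrt_le_iff.2 ⟨by positivity, ?_⟩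
    rw [mul_pow, Real.sq_sqrt (by positivity)]
    calc α * (1 - α) / t * (α * x) = α ^ 2 * (x / t) * (1 - α) := by ring
      _ ≤ α ^ 2 * (x / t) := mul_le_of_le_one_right (by positivity) (by linarith)
  calc _ ≤ 1 / α * √(x / t) + 2 * (α * √(x / t) / α ^ 2) := by gcongr
    _ = _ := by field_simp; ring

theorem IsRegularPath.congaError_le (hα₀ : 0 < α) (hα₁ : α < 1) (ht : Real.exp 2 ≤ t)
    (hx : 1 / t ≤ x) (hxα : x ≤ α) {w : ℝ≥0 → EuclideanSpace ℝ (Fin 2)}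
    (hw : IsRegularPath w (2 + Real.log t)) :
    congaError α t w x ≤ (540 / α + 180) * congaRate t x := by
  have ht0 : 0 < t := (Real.exp_pos 2).trans_le ht
  have ht1 : 1 < t := (Real.one_lt_exp_iff.2 two_pos).trans_le ht
  have hx0 : 0 < x := (by positivity : (0 : ℝ) < 1 / t).trans_le hx
  have hσ : 0 < congaSigma α t :=
    div_pos (Real.sqrt_pos.2 (mul_pos hα₀ (by linarith))) (Real.sqrt_pos.2 ht0)
  have hL : 0 < Real.log (t / x) := Real.log_pos ((one_lt_div hx0).2 (by linarith))
  have hm : 0 < √(x / t) := Real.sqrt_pos.2 (by positivity)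
  have hr : 0 < congaRate t x := by rw [congaRate_eq]; exact Real.sqrt_pos.2 (mul_pos hm hL)
  have hr2 : congaRate t x ^ 2 = √(x / t) * Real.log (t / x) := by
    rw [congaRate_eq, Real.sq_sqrt (mul_pos hm hL).le]
  have hμ : x / α ≤ 1 := (div_le_one hα₀).2 hxα
  have hμ0 : 0 < x / α := by positivity
  set p := 180 * Real.log (t / x) / congaRate t x with hp
  have hp0 : 0 ≤ p := by positivity
  have hbound : ∀ s, 0 < s →
      ‖w (Real.toNNReal (1 - s)) - w (Real.toNNReal (1 - x / α))‖ ≤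
        p * |s - x / α| + 180 * congaRate t x := by
    intro s hs
    -- Clamping at 0 is 1-Lipschitz, so the modulus on `[0, 1]` also covers `s > 1`.
    have hmax : Real.toNNReal (1 - s) = Real.toNNReal (max (1 - s) 0) := by
      ext; simp
    rw [hmax]
    refine (hw.norm_sub_le ht hx0 (hxα.trans hα₁.le)
      ⟨le_max_right _ _, max_le (by linarith) zero_le_one⟩
      ⟨by linarith, by linarith⟩).trans ?_
    have habs : |max (1 - s) 0 - (1 - x / α)| ≤ |s - x / α| := by
      calc _ = |max (1 - s) 0 - max (1 - x / α) 0| := by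
            rw [max_eq_left (by linarith : 0 ≤ 1 - x / α)]
        _ ≤ |(1 - s) - (1 - x / α)| := abs_max_sub_max_le_abs _ _ _
        _ = _ := by rw [abs_sub_comm]; ring_nf
    gcongr
  refine (congaError_le_of_linear_bound hα₀ hσ hx0 hw.cont hw.zero hp0 hbound).trans ?_
  -- Slope times moment scale is again the rate, because the rate squared is `√(x/t) log(t/x)`: the
  -- two halves of the affine bound balance.
  have hpm : p * √(x / t) = 180 * congaRate t x := by
    rw [hp, div_mul_eq_mul_div, div_eq_iff hr.ne']
    linear_combination -180 * hr2
  calc _ ≤ p * (3 / α * √(x / t)) + 180 * congaRate t x := by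
        gcongr; exact congaSigma_moment_le hα₀ hα₁ ht0 hx
    _ = _ := by linear_combination 3 / α * hpm

theorem congaRate_le (ht : 1 < t) (hx : 1 / t ≤ x) (hx1 : x ≤ 1) :
    congaRate t x ≤ 2 * (t ^ (-(1 / 4) : ℝ) * √(Real.log t)) := by
  have ht0 : 0 < t := by linarith
  have hx0 : 0 < x := (by positivity : (0 : ℝ) < 1 / t).trans_le hx
  have hlogt := Real.log_pos ht
  have hsq : √(t⁻¹) = (t ^ (-(1 / 4) : ℝ)) ^ 2 := by
    rw [Real.sqrt_eq_rpow, Real.inv_rpow ht0.le, ← Real.rpow_neg ht0.le, ← Real.rpow_natCast,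
      ← Real.rpow_mul ht0.le]
    norm_num
  -- The proof gives 2; the weaker 4 is a perfect square, matching the factor 2 outside the root.
  have hlog : Real.log (t / x) ≤ 4 * Real.log t := by
    have h1 : t / x ≤ t ^ 2 := by
      rw [div_le_iff₀ hx0]
      calc t = t ^ 2 * (1 / t) := by field_simp
        _ ≤ t ^ 2 * x := by gcongr
    have h2 := Real.log_le_log (by positivity) h1
    rw [Real.log_pow] at h2
    push_cast at h2
    linarith
  rw [congaRate_eq]
  apply Real.sqrt_le_iff.2 ⟨by positivity, ?_⟩
  rw [mul_pow, mul_pow, Real.sq_sqrt hlogt.le, ← hsq]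
  calc √(x / t) * Real.log (t / x) ≤ √(t⁻¹) * (4 * Real.log t) := by
        have hxt : x / t ≤ t⁻¹ := by
          rw [div_eq_mul_inv]; exact mul_le_of_le_one_left (by positivity) hx1
        exact mul_le_mul (Real.sqrt_le_sqrt hxt) hlog
          (Real.log_nonneg ((one_le_div hx0).2 (by linarith))) (Real.sqrt_nonneg _)
    _ = _ := by ring

/-- With `v = σ_t² x ≤ 1/t`, squaring admissibility gives `x² > M v log v⁻¹ ≥ M v log t`. The lower
bound on `t` is what makes the right side at least `x/t`. -/
theorem one_div_le_of_congaAdmissible {M : ℝ} (hα₀ : 0 < α) (hα₁ : α < 1) (hM : 0 < M)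
    (ht : 1 ≤ t) (htM : Real.exp (1 / (M * (α * (1 - α)))) ≤ t) (hx : x ∈ congaAdmissible α M t) :
    1 / t ≤ x := by
  obtain ⟨⟨hx0, hxα⟩, hadm⟩ := hx
  have ht0 : 0 < t := by linarith
  have hα : 0 < α * (1 - α) := mul_pos hα₀ (by linarith)
  have hσ2 : congaSigma α t ^ 2 = α * (1 - α) / t := by
    rw [congaSigma, div_pow, Real.sq_sqrt hα.le, Real.sq_sqrt ht0.le]
  rw [congaWindow, mul_inv_cancel_left₀ hα₀.ne', hσ2] at hadm
  have hv : α * (1 - α) / t * x ≤ t⁻¹ := by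
    rw [div_mul_eq_mul_div, inv_eq_one_div]
    gcongr
    nlinarith
  have hlog : 1 / (M * (α * (1 - α))) ≤ -Real.log (α * (1 - α) / t * x) := by
    have h1 := Real.log_le_log (by positivity) hv
    have h2 := (Real.le_log_iff_exp_le ht0).2 htM
    rw [Real.log_inv] at h1
    linarith
  have hsq : -(M * (α * (1 - α) / t * x) * Real.log (α * (1 - α) / t * x)) < x ^ 2 :=
    (Real.sqrt_lt' hx0).1 hadm
  have hlow : 1 / t * x ≤ -(M * (α * (1 - α) / t * x) * Real.log (α * (1 - α) / t * x)) := by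
    calc 1 / t * x = M * (α * (1 - α) / t * x) * (1 / (M * (α * (1 - α)))) := by
          have : 1 - α ≠ 0 := by linarith
          field_simp
      _ ≤ M * (α * (1 - α) / t * x) * -Real.log (α * (1 - α) / t * x) := by gcongr
      _ = _ := by ring
  exact le_of_mul_le_mul_right (by linarith [sq x]) hx0

theorem one_div_le_of_rpow_le {β : ℝ} (hβ : β < 1) (ht : 1 ≤ t) (hx : t ^ (-β) ≤ x) :
    1 / t ≤ x := by
  refine le_trans ?_ hx
  rw [one_div, ← Real.rpow_neg_one]
  exact Real.rpow_le_rpow_of_exponent_le ht (by linarith)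

end Estimate

theorem mainTheorem6 (α : ℝ) (hα₀ : 0 < α) (hα₁ : α < 1) :
    ∃ κ : ℝ, 0 < κ ∧ ∃ t₀ : ℝ → ℝ,
      ∀ (Ω : Type u) [MeasurableSpace Ω] (P : Measure Ω) [IsProbabilityMeasure P]
        (W : ℝ≥0 → Ω → EuclideanSpace ℝ (Fin 2)), IsPlanarBrownian W P →
        (∀ M : ℝ, 0 < M → ∀ᵐ ω ∂P, ∃ T : ℝ, 0 < T ∧ ∀ t : ℝ, T ≤ t →
          ∀ x ∈ congaAdmissible α M t,
            congaError α t (fun s => W s ω) x ≤ κ * congaRate t x) ∧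
        (∀ β ∈ Set.Ioo (0 : ℝ) 1, ∀ᵐ ω ∂P, ∃ T : ℝ, 0 < T ∧ ∀ t : ℝ, T ≤ t →
          ∀ x ∈ Set.Icc (t ^ (-β)) α,
            congaError α t (fun s => W s ω) x ≤ κ * congaRate t x) ∧
        (∀ β ∈ Set.Ioo (0 : ℝ) 1, ∀ t : ℝ, t₀ β ≤ t →
          P {ω | ∃ x ∈ Set.Icc (t ^ (-β)) α,
            κ * congaRate t x < congaError α t (fun s => W s ω) x} ≤
              ENNReal.ofReal (t ^ (-2 : ℝ))) ∧
        (∀ M : ℝ, 0 < M → ∀ᵐ ω ∂P, ∃ T : ℝ, 0 < T ∧ ∀ t : ℝ, T ≤ t →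
          ∀ x ∈ congaAdmissible α M t,
            congaError α t (fun s => W s ω) x ≤
              κ * (t ^ (-(1 / 4) : ℝ) * √(Real.log t))) := by
  have hexp : (1 : ℝ) < Real.exp 2 := Real.one_lt_exp_iff.2 two_pos
  set κ₀ := 540 / α + 180 with hκ₀
  have hκ0 : 0 < κ₀ := by positivity
  have hle (t x : ℝ) : κ₀ * congaRate t x ≤ 2 * κ₀ * congaRate t x := by
    have : 0 ≤ congaRate t x := Real.sqrt_nonneg _
    gcongr
    linarith
  -- The factor 2 is lost in `congaRate_le` for the last claim; the other three hold with `κ₀`. The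
  -- threshold `e²` serves every `β`.
  refine ⟨2 * κ₀, by positivity, fun _ => Real.exp 2, fun Ω _ P _ W hW => ⟨fun M hM => ?_,
    fun β hβ => ?_, fun β hβ t ht => ?_, fun M hM => ?_⟩⟩
  · filter_upwards [ae_eventually_isRegularPath hW] with ω ⟨T, hT, hreg⟩
    refine ⟨max T (max (Real.exp 2) (Real.exp (1 / (M * (α * (1 - α)))))), by positivity,
      fun t ht x hx => ?_⟩
    simp only [max_le_iff] at ht
    exact ((hreg t ht.1).congaError_le hα₀ hα₁ ht.2.1 (one_div_le_of_congaAdmissible hα₀ hα₁ hM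
      (hexp.le.trans ht.2.1) ht.2.2 hx) hx.1.2).trans (hle t x)
  · filter_upwards [ae_eventually_isRegularPath hW] with ω ⟨T, hT, hreg⟩
    refine ⟨max T (Real.exp 2), by positivity, fun t ht x hx => ?_⟩
    simp only [max_le_iff] at ht
    exact ((hreg t ht.1).congaError_le hα₀ hα₁ ht.2 (one_div_le_of_rpow_le hβ.2
      (hexp.le.trans ht.2) hx.1) hx.2).trans (hle t x)
  · refine (measure_mono ?_).trans (measure_not_isRegularPath_le hW (hexp.le.trans ht))
    rintro ω ⟨x, hx, hlt⟩ hreg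
    exact absurd hlt (not_lt.2 ((hreg.congaError_le hα₀ hα₁ ht (one_div_le_of_rpow_le hβ.2
      (hexp.le.trans ht) hx.1) hx.2).trans (hle t x)))
  · filter_upwards [ae_eventually_isRegularPath hW] with ω ⟨T, hT, hreg⟩
    refine ⟨max T (max (Real.exp 2) (Real.exp (1 / (M * (α * (1 - α)))))), by positivity,
      fun t ht x hx => ?_⟩
    simp only [max_le_iff] at ht
    have hxt := one_div_le_of_congaAdmissible hα₀ hα₁ hM (hexp.le.trans ht.2.1) ht.2.2 hx
    refine ((hreg t ht.1).congaError_le hα₀ hα₁ ht.2.1 hxt hx.1.2).trans ?_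
    calc κ₀ * congaRate t x ≤ κ₀ * (2 * (t ^ (-(1 / 4) : ℝ) * √(Real.log t))) := by
          gcongr
          exact congaRate_le (hexp.trans_le ht.2.1) hxt (hx.1.2.trans hα₁.le)
      _ = _ := by ring
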